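/- Let $X$ be a complex manifold of dimension $n$ and let $(E,h^E)$ be a holomorphic vector bundle of rank $r$ over $X$ with a smooth Hermitian metric (linear in the first and conjugate linear in the second variable). Let $R^E$ be its Chern curvature: for a local holomorphic frame $(e_i)$ and local holomorphic coordinates $(z^\alpha)$, with $\partial_\alpha=\partial/\partial z^\alpha$ and $h_{i\bar k}=h^E(e_i,e_k)$ (and $(h^{\bar k j})$ the inverse matrix), set $\theta^j_i=\partial h_{i\bar k}\,h^{\bar k j}$, $R^j_i=\bar\partial\theta^j_i=R^j_{i\alpha\bar\beta}\,dz^\alpha\wedge d\bar z^\beta$ and $R_{i\bar j\alpha\bar\beta}=R^k_{i\alpha\bar\beta}h_{k\bar j}$ (summation convention). We say that $(E,h^E)$ is *strongly decomposably positive of type I* if for every $x\in X$ there is a decomposition $T^{1,0}_xX=U_x\oplus V_x$ such that - $R_{i\bar j\alpha\bar\beta}u^{i\alpha}\overline{u^{j\beta}}>0$ for every non-zero $u=u^{i\alpha}e_i\otimes\partial_\alpha\in E_x\otimes U_x$; - $R_{i\bar j\alpha\bar\beta}u^{i\alpha}\overline{v'^{j\beta}}=0$ for all $u=u^{i\alpha}e_i\otimes\partial_\alpha\in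 E_x\otimes U_x$ and $v'=v'^{j\beta}e_j\otimes\partial_\beta\in E_x\otimes V_x$; - $R_{i\bar j\alpha\bar\beta}v^{\bar j\alpha}\overline{v^{\bar i\beta}}>0$ for every non-zero $v=v^{\bar j\alpha}\bar e_j\otimes\partial_\alpha\in\overline{E}_x\otimes V_x$. We say that $(E,h^E)$ is *strongly decomposably positive of type II* if for every $x\in X$ there is an orthogonal decomposition $E_x=E_{1,x}\oplus E_{2,x}$ with respect to which $R^E_x$ is block diagonal (all endomorphisms $R^E_x(v,\bar w)$, $v,w\in T^{1,0}_xX$, preserve $E_{1,x}$ and $E_{2,x}$), and such that - $R_{i\bar j\alpha\bar\beta}u^{i\alpha}\overline{u^{j\beta}}>0$ for every non-zero $u=u^{i\alpha}e_i\otimes\partial_\alpha\in E_{1,x}\otimes T^{1,0}_xX$; - $R_{i\bar j\alpha\bar\beta}v^{i\bar\beta}\overline{v^{j\bar\alpha}}>0$ for every non-zero $v=v^{i\bar\beta}e_i\otimes\partial_{\bar\beta}\in E_{2,x}\otimes T^{0,1}_xX$. We say that $(E,h^E)$ is *decomposably positive* (Finski) if for every $x\in X$ there are a number $N\in\mathbb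 N$, sesquilinear forms $l_p:T^{1,0}_xX\times E_x\to\mathbb C$ (conjugate linear in the first and linear in the second variable) and bilinear forms $l'_p:T^{1,0}_xX\times E_x\to\mathbb C$, $p=1,\dots,N$, such that for all $v\in T^{1,0}_xX$ and $\xi\in E_x$ $$\frac1{2\pi}\langle R^E_x(v,\bar v)\xi,\xi\rangle_{h^E}=\sum_{p=1}^N|l_p(v,\xi)|^2+\sum_{p=1}^N|l'_p(v,\xi)|^2,$$ and moreover $\langle R^E_x(v,\bar v)\xi,\xi\rangle_{h^E}\neq0$ whenever $v\neq0$ and $\xi\neq0$. **Corollary 2.6.** If $(E,h^E)$ is strongly decomposably positive of type I or of type II, then $(E,h^E)$ is decomposably positive. -/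

import Mathlib

open Bundle Module
open scoped Manifold ContDiff ComplexConjugate ComplexOrder Matrix

noncomputable section

/-! A complex manifold `X` of dimension `n` is a manifold modelled holomorphically on `ℂⁿ`; its
tangent space over `ℂ` at `x`, `TangentSpace 𝓘(ℂ, ℂⁿ) x`, is the holomorphic tangent space
`T¹'⁰ₓX`. A holomorphic vector bundle of rank `r` is a holomorphic vector bundle over `ℂ` with
model fibre `ℂʳ`. -/

/-- The model space `ℂᵏ`. -/
abbrev CSpace (k : ℕ) : Type := EuclideanSpace ℂ (Fin k)

/-- The Wirtinger derivative `∂f/∂z^α`, where `z^α = x^α + √-1 y^α`. -/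
def wirtinger {n : ℕ} (α : Fin n) (f : CSpace n → ℂ) (z : CSpace n) : ℂ :=
  (1 / 2) * (fderiv ℝ f z (EuclideanSpace.single α 1)
    - Complex.I * fderiv ℝ f z (EuclideanSpace.single α Complex.I))

/-- The conjugate Wirtinger derivative `∂f/∂z̄^α`. -/
def wirtingerBar {n : ℕ} (α : Fin n) (f : CSpace n → ℂ) (z : CSpace n) : ℂ :=
  (1 / 2) * (fderiv ℝ f z (EuclideanSpace.single α 1)
    + Complex.I * fderiv ℝ f z (EuclideanSpace.single α Complex.I))

/-- The standard basis of `ℂᵏ`. -/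
def stdBasis (k : ℕ) : Basis (Fin k) ℂ (CSpace k) :=
  (EuclideanSpace.basisFun (Fin k) ℂ).toBasis

section TangentFrame

variable {n : ℕ} {X : Type*} [TopologicalSpace X] [ChartedSpace (CSpace n) X]

/-- The coordinate frame `(∂_α)` of `T¹'⁰ₓX` given by the coordinates `chartAt x`
(Mathlib identifies the tangent space at `x` with the model space through this chart). -/
def tangentFrame (x : X) : Basis (Fin n) ℂ (TangentSpace 𝓘(ℂ, CSpace n) x) :=
  stdBasis n

end TangentFrame

section HermitianBundle

variable {n r : ℕ} {X : Type*} [TopologicalSpace X] [ChartedSpace (CSpace n) X]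
  (E : X → Type*) [∀ x, AddCommGroup (E x)] [∀ x, Module ℂ (E x)] [∀ x, TopologicalSpace (E x)]
  [TopologicalSpace (TotalSpace (CSpace r) E)] [FiberBundle (CSpace r) E]
  [VectorBundle ℂ (CSpace r) E]

/-- The local holomorphic frame `(e_i)` of `E` over a neighbourhood of `x₀`, coming from the
preferred local trivialization of `E` at `x₀`. -/
def localHolFrame (x₀ : X) (i : Fin r) (y : X) : E y :=
  (trivializationAt (CSpace r) E x₀).localFrame (stdBasis r) i y

/-- The basis `(e_i(x))` of the fibre `E_x`. -/
def fibreFrame (x : X) : Basis (Fin r) ℂ (E x) :=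
  (trivializationAt (CSpace r) E x).basisAt (stdBasis r)
    (FiberBundle.mem_baseSet_trivializationAt (CSpace r) E x)

/-- The local frame `(e_i)` around `x` takes the value `fibreFrame E x` at `x`. -/
theorem localHolFrame_self (x : X) (i : Fin r) : localHolFrame E x i x = fibreFrame E x i :=
  (trivializationAt (CSpace r) E x).localFrame_apply_of_mem_baseSet (stdBasis r)
    (FiberBundle.mem_baseSet_trivializationAt (CSpace r) E x)

variable (n r) in
/-- The part of the coordinate chart at `x₀` over which the local frame at `x₀` is defined. -/
def frameDomain (x₀ : X) : Set (CSpace n) :=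
  {z | z ∈ (chartAt (CSpace n) x₀).target ∧
    (chartAt (CSpace n) x₀).symm z ∈ (trivializationAt (CSpace r) E x₀).baseSet}

variable (n r) in
/-- A (smooth) Hermitian metric on `E`: a family of Hermitian inner products on the fibres, linear
in the first and conjugate linear in the second variable, with coefficients `h(e_i, e_j)` that are
`C^∞` functions of the (real) coordinates. -/
structure HermitianMetric where
  /-- The sesquilinear form on each fibre. -/
  form : ∀ x, E x →ₗ[ℂ] E x →ₗ⋆[ℂ] ℂ
  conj_symm : ∀ x (ξ η : E x), conj (form x ξ η) = form x η ξ
  pos : ∀ x (ξ : E x), ξ ≠ 0 → 0 < form x ξ ξ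
  smooth : ∀ (x₀ : X) (i j : Fin r),
    ContDiffOn ℝ ∞
      (fun z : CSpace n => form ((chartAt (CSpace n) x₀).symm z)
        (localHolFrame E x₀ i ((chartAt (CSpace n) x₀).symm z))
        (localHolFrame E x₀ j ((chartAt (CSpace n) x₀).symm z)))
      (frameDomain n r E x₀)

namespace HermitianMetric

variable {E} (h : HermitianMetric n r E)

/-- The matrix `(h_{i k̄})` (`i` row, `k` column), `h_{i k̄} = h(e_i, e_k)`, of the metric in the
local holomorphic frame around `x₀`, as a function of the coordinates around `x₀`. -/
def localMatrix (x₀ : X) (z : CSpace n) : Matrix (Fin r) (Fin r) ℂ :=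
  Matrix.of fun i k => h.form ((chartAt (CSpace n) x₀).symm z)
    (localHolFrame E x₀ i ((chartAt (CSpace n) x₀).symm z))
    (localHolFrame E x₀ k ((chartAt (CSpace n) x₀).symm z))

/-- The coefficient `θ^j_{i α}` of `dz^α` in the connection form `θ^j_i = ∂h_{i k̄} h^{k̄ j}` of the
Chern connection, in the local holomorphic frame and coordinates around `x₀`. -/
def connectionForm (x₀ : X) (j i : Fin r) (α : Fin n) (z : CSpace n) : ℂ :=
  ∑ k, wirtinger α (fun w => h.localMatrix x₀ w i k) z * (h.localMatrix x₀ z)⁻¹ k j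

/-- The matrix `(R^j_{i α β̄})` (`j` row, `i` column) of coefficients of `dz^α ∧ dz̄^β` in the Chern
curvature `R^j_i = ∂̄θ^j_i` at `x`; as `dz̄^β ∧ dz^α = - dz^α ∧ dz̄^β`, it equals
`- ∂θ^j_{i α}/∂z̄^β`. -/
def curvatureMatrix (x : X) (α β : Fin n) : Matrix (Fin r) (Fin r) ℂ :=
  Matrix.of fun j i =>
    - wirtingerBar β (h.connectionForm x j i α) (chartAt (CSpace n) x x)

/-- The Chern curvature endomorphism `R_x(v, w̄) = v^α w̄^β R^j_{i α β̄} e_j ⊗ e^i` of `E_x`, for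
`v, w ∈ T¹'⁰ₓX`. -/
def chernCurvature (x : X) (v w : TangentSpace 𝓘(ℂ, CSpace n) x) : E x →ₗ[ℂ] E x :=
  ∑ α, ∑ β, ((tangentFrame x).repr v α * conj ((tangentFrame x).repr w β)) •
    Matrix.toLin (fibreFrame E x) (fibreFrame E x) (h.curvatureMatrix x α β)

/-- The component `R_{i j̄ α β̄} = R^k_{i α β̄} h_{k j̄}`, that is, `⟨R(∂_α, ∂_β̄) e_i, e_j⟩`, at `x`. -/
def curvatureCoeff (x : X) (i j : Fin r) (α β : Fin n) : ℂ :=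
  h.form x (h.chernCurvature x (tangentFrame x α) (tangentFrame x β) (fibreFrame E x i))
    (fibreFrame E x j)

/-- The Nakano form `R_{i j̄ α β̄} u^{iα} \overline{w^{jβ}}` at `x`, for the tensors
`u^{iα} e_i ⊗ ∂_α` and `w^{jβ} e_j ⊗ ∂_β` of `E_x ⊗ T¹'⁰ₓX`. -/
def nakanoForm (x : X) (u w : Fin r → Fin n → ℂ) : ℂ :=
  ∑ i, ∑ j, ∑ α, ∑ β, h.curvatureCoeff x i j α β * u i α * conj (w j β)

/-- The dual Nakano form `R_{i j̄ α β̄} v^{j̄α} \overline{v^{īβ}}` at `x`, for the tensor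
`v^{j̄α} ē_j ⊗ ∂_α` of `Ē_x ⊗ T¹'⁰ₓX`. -/
def dualNakanoForm (x : X) (v : Fin r → Fin n → ℂ) : ℂ :=
  ∑ i, ∑ j, ∑ α, ∑ β, h.curvatureCoeff x i j α β * v j α * conj (v i β)

/-- Strong decomposable positivity of type I: at each point `x` there is a decomposition
`T¹'⁰ₓX = U ⊕ V` such that the curvature is Nakano positive on `E_x ⊗ U`, dual Nakano positive on
`Ē_x ⊗ V`, and the cross terms between `E_x ⊗ U` and `E_x ⊗ V` vanish. As `(e_i)` is a basis of
`E_x`, a tensor `u^{iα} e_i ⊗ ∂_α` lies in `E_x ⊗ U` iff `u^{iα} ∂_α ∈ U` for every `i`; likewise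
for `Ē_x ⊗ V` with the basis `(ē_i)`. -/
def StronglyDecomposablyPositiveI : Prop :=
  ∀ x : X, ∃ U V : Submodule ℂ (TangentSpace 𝓘(ℂ, CSpace n) x), IsCompl U V ∧
    (∀ u : Fin r → Fin n → ℂ, (∀ i, ∑ α, u i α • tangentFrame x α ∈ U) → u ≠ 0 →
      0 < h.nakanoForm x u u) ∧
    (∀ u v' : Fin r → Fin n → ℂ, (∀ i, ∑ α, u i α • tangentFrame x α ∈ U) →
      (∀ j, ∑ β, v' j β • tangentFrame x β ∈ V) → h.nakanoForm x u v' = 0) ∧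
    (∀ v : Fin r → Fin n → ℂ, (∀ j, ∑ α, v j α • tangentFrame x α ∈ V) → v ≠ 0 →
      0 < h.dualNakanoForm x v)

/-- Strong decomposable positivity of type II: at each point `x` there is an orthogonal
decomposition `E_x = E₁ ⊕ E₂` for which the Chern curvature is block diagonal (the curvature
endomorphisms preserve `E₁` and `E₂`), Nakano positive on `E₁ ⊗ T¹'⁰ₓX`, and with
`R_{i j̄ α β̄} v^{i β̄} \overline{v^{j ᾱ}} > 0` for non-zero `v = v^{i β̄} e_i ⊗ ∂_β̄` in
`E₂ ⊗ T⁰'¹ₓX`. As `(∂_α)` is a basis, `u^{iα} e_i ⊗ ∂_α` lies in `E₁ ⊗ T¹'⁰ₓX` iff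
`u^{iα} e_i ∈ E₁` for every `α`; likewise for `E₂ ⊗ T⁰'¹ₓX` with the basis `(∂_β̄)`. -/
def StronglyDecomposablyPositiveII : Prop :=
  ∀ x : X, ∃ E₁ E₂ : Submodule ℂ (E x), IsCompl E₁ E₂ ∧
    (∀ ξ ∈ E₁, ∀ η ∈ E₂, h.form x ξ η = 0) ∧
    (∀ v w : TangentSpace 𝓘(ℂ, CSpace n) x,
      (∀ ξ ∈ E₁, h.chernCurvature x v w ξ ∈ E₁) ∧ (∀ η ∈ E₂, h.chernCurvature x v w η ∈ E₂)) ∧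
    (∀ u : Fin r → Fin n → ℂ, (∀ α, ∑ i, u i α • fibreFrame E x i ∈ E₁) → u ≠ 0 →
      0 < h.nakanoForm x u u) ∧
    (∀ v : Fin r → Fin n → ℂ, (∀ β, ∑ i, v i β • fibreFrame E x i ∈ E₂) → v ≠ 0 →
      0 < ∑ i, ∑ j, ∑ α, ∑ β, h.curvatureCoeff x i j α β * v i β * conj (v j α))

/-- Decomposable non-negativity: at each point `x`, `(1/2π) ⟨R_x(v, v̄)ξ, ξ⟩` is a finite sum of
squared moduli of forms `l_p(v, ξ)` that are sesquilinear and `l'_p(v, ξ)` that are bilinear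
(linear on `T¹'⁰ₓX ⊗ E_x`). -/
def DecomposablyNonneg : Prop :=
  ∀ x : X, ∃ (N : ℕ)
    (l : Fin N → TangentSpace 𝓘(ℂ, CSpace n) x →ₗ⋆[ℂ] E x →ₗ[ℂ] ℂ)
    (l' : Fin N → TangentSpace 𝓘(ℂ, CSpace n) x →ₗ[ℂ] E x →ₗ[ℂ] ℂ),
    ∀ (v : TangentSpace 𝓘(ℂ, CSpace n) x) (ξ : E x),
      (1 / (2 * Real.pi) : ℂ) * h.form x (h.chernCurvature x v v ξ) ξ =
        ((∑ p, ‖l p v ξ‖ ^ 2 + ∑ p, ‖l' p v ξ‖ ^ 2 : ℝ) : ℂ)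

/-- Decomposable positivity: decomposable non-negativity, and moreover `⟨R_x(v, v̄)ξ, ξ⟩ ≠ 0` for
non-zero `v` and `ξ`. -/
def DecomposablyPositive : Prop :=
  h.DecomposablyNonneg ∧
    ∀ (x : X) (v : TangentSpace 𝓘(ℂ, CSpace n) x) (ξ : E x), v ≠ 0 → ξ ≠ 0 →
      h.form x (h.chernCurvature x v v ξ) ξ ≠ 0

end HermitianMetric

end HermitianBundle

end

/-!
A non-negative sesquilinear form on a finite-dimensional space is a finite sum of squared moduli of
linear forms. Substituting `u = ξ ⊗ v`, which is bilinear in `(v, ξ)`, into the Nakano part of the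
curvature form yields the bilinear forms `l'_p`. The dual Nakano part becomes a sesquilinear form in
`ξ ⊗ v̄`, which is conjugate linear in `v`, and yields the sesquilinear forms `l_p`. The cross terms
vanish in both orders because the Chern curvature is Hermitian, `R_{i j̄ α β̄}‾ = R_{j ī β ᾱ}`: with
`H = (h_{i k̄})`, the identity `θ H = ∂H` gives `R_{α β̄} H = ∂_α H H⁻¹ ∂_β̄ H - ∂_β̄ ∂_α H`, and
`∂_α`, `∂_β̄` commute.
-/

section SumsOfSquares

variable {T F W : Type*} [AddCommGroup T] [Module ℂ T] [AddCommGroup F] [Module ℂ F]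
  [AddCommGroup W] [Module ℂ W]

theorem isSymm_of_isNonneg {Q : W →ₗ⋆[ℂ] W →ₗ[ℂ] ℂ} (hQ : Q.IsNonneg) : Q.IsSymm := by
  have im_self (u : W) : (Q u u).im = 0 := (Complex.nonneg_iff.1 (hQ.nonneg u)).2.symm
  refine ⟨fun u w => ?_⟩
  have hu := im_self u
  have hw := im_self w
  have h_add := im_self (u + w)
  have h_add_I := im_self (u + Complex.I • w)
  simp only [map_add, map_smul, LinearMap.add_apply, LinearMap.smul_apply, LinearMap.map_smulₛₗ,
    smul_eq_mul, Complex.conj_I, Complex.add_re, Complex.add_im, Complex.mul_re, Complex.mul_im,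
    Complex.neg_re, Complex.neg_im, Complex.I_re, Complex.I_im] at h_add h_add_I
  apply Complex.ext <;> simp only [Complex.conj_re, Complex.conj_im] <;> linarith

open scoped MatrixOrder in
theorem exists_eq_sum_norm_sq_of_isNonneg [FiniteDimensional ℂ W] {Q : W →ₗ⋆[ℂ] W →ₗ[ℂ] ℂ}
    (hQ : Q.IsNonneg) :
    ∃ φ : Fin (finrank ℂ W) → W →ₗ[ℂ] ℂ, ∀ u, Q u u = ((∑ p, ‖φ p u‖ ^ 2 : ℝ) : ℂ) := by
  let b := finBasis ℂ W
  have hA : (LinearMap.toMatrix₂ b b Q).PosSemidef :=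
    (LinearMap.isPosSemidef_iff_posSemidef_toMatrix b).1 ⟨isSymm_of_isNonneg hQ, hQ⟩
  obtain ⟨B, hB⟩ := CStarAlgebra.nonneg_iff_eq_star_mul_self.1 hA.nonneg
  refine ⟨fun p => LinearMap.proj p ∘ₗ B.mulVecLin ∘ₗ b.equivFun.toLinearMap, fun u => ?_⟩
  calc Q u u = star (B *ᵥ b.equivFun u) ⬝ᵥ B *ᵥ b.equivFun u := by
        rw [apply_eq_star_dotProduct_toMatrix₂_mulVec b, hB, Matrix.star_eq_conjTranspose,
          ← Matrix.mulVec_mulVec, Matrix.dotProduct_mulVec, Matrix.vecMul_conjTranspose, star_star]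
        rfl
    _ = _ := by simp [dotProduct, Complex.conj_mul']

/-- The sesquilinear form `Q` is positive definite on the subspace `S`. -/
def IsPosDefOn (Q : W →ₗ⋆[ℂ] W →ₗ[ℂ] ℂ) (S : Submodule ℂ W) : Prop :=
  ∀ u ∈ S, u ≠ 0 → 0 < Q u u

theorem IsPosDefOn.nonneg {Q : W →ₗ⋆[ℂ] W →ₗ[ℂ] ℂ} {S : Submodule ℂ W} (hQ : IsPosDefOn Q S)
    {u : W} (hu : u ∈ S) : 0 ≤ Q u u := by
  rcases eq_or_ne u 0 with rfl | h0
  · simp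
  · exact (hQ u hu h0).le

theorem exists_eq_sum_norm_sq_of_mem [FiniteDimensional ℂ W] {σ : ℂ →+* ℂ}
    {Q : W →ₗ⋆[ℂ] W →ₗ[ℂ] ℂ} {S : Submodule ℂ W} (hQ : ∀ u ∈ S, 0 ≤ Q u u)
    {B : T →ₛₗ[σ] F →ₗ[ℂ] W} (hB : ∀ v ξ, B v ξ ∈ S) :
    ∃ (N : ℕ) (l : Fin N → T →ₛₗ[σ] F →ₗ[ℂ] ℂ),
      ∀ v ξ, Q (B v ξ) (B v ξ) = ((∑ p, ‖l p v ξ‖ ^ 2 : ℝ) : ℂ) := by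
  have hQS : (Q.domRestrict₁₂ S S).IsNonneg := ⟨fun u => hQ u u.2⟩
  obtain ⟨φ, hφ⟩ := exists_eq_sum_norm_sq_of_isNonneg hQS
  choose ψ hψ using fun p => (φ p).exists_extend
  refine ⟨_, fun p => B.compr₂ₛₗ (ψ p), fun v ξ => ?_⟩
  have hψφ (p) : ψ p (B v ξ) = φ p ⟨B v ξ, hB v ξ⟩ := LinearMap.congr_fun (hψ p) ⟨B v ξ, hB v ξ⟩
  simpa only [LinearMap.compr₂ₛₗ_apply, hψφ, LinearMap.domRestrict₁₂_apply] using hφ ⟨B v ξ, hB v ξ⟩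

/-- `f` is a finite sum of squared moduli of sesquilinear forms `l p` and bilinear forms `l' p`;
the same number `N` of each loses no generality, as forms may vanish. -/
def IsDecomposable (f : T → F → ℂ) : Prop :=
  ∃ (N : ℕ) (l : Fin N → T →ₗ⋆[ℂ] F →ₗ[ℂ] ℂ) (l' : Fin N → T →ₗ[ℂ] F →ₗ[ℂ] ℂ),
    ∀ v ξ, f v ξ = ((∑ p, ‖l p v ξ‖ ^ 2 + ∑ p, ‖l' p v ξ‖ ^ 2 : ℝ) : ℂ)

namespace IsDecomposable

variable {f g : T → F → ℂ}

theorem add (hf : IsDecomposable f) (hg : IsDecomposable g) :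
    IsDecomposable fun v ξ => f v ξ + g v ξ := by
  obtain ⟨M, l, l', hl⟩ := hf
  obtain ⟨N, m, m', hm⟩ := hg
  refine ⟨M + N, Fin.append l m, Fin.append l' m', fun v ξ => ?_⟩
  simp only [hl, hm, Fin.sum_univ_add, Fin.append_left, Fin.append_right]
  push_cast
  ring

theorem const_mul (hf : IsDecomposable f) {c : ℝ} (hc : 0 ≤ c) :
    IsDecomposable fun v ξ => c * f v ξ := by
  obtain ⟨N, l, l', hl⟩ := hf
  refine ⟨N, fun p => (√c : ℂ) • l p, fun p => (√c : ℂ) • l' p, fun v ξ => ?_⟩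
  have norm_sq_smul (a : ℂ) : ‖(√c : ℂ) * a‖ ^ 2 = c * ‖a‖ ^ 2 := by
    rw [norm_mul, mul_pow, Complex.norm_real, Real.norm_eq_abs, sq_abs, Real.sq_sqrt hc]
  simp only [LinearMap.smul_apply, smul_eq_mul, norm_sq_smul, ← Finset.mul_sum, ← mul_add, hl,
    Complex.ofReal_mul]

variable [FiniteDimensional ℂ W] {Q : W →ₗ⋆[ℂ] W →ₗ[ℂ] ℂ} {S : Submodule ℂ W}

theorem of_bilinear (hQ : ∀ u ∈ S, 0 ≤ Q u u) {B : T →ₗ[ℂ] F →ₗ[ℂ] W} (hB : ∀ v ξ, B v ξ ∈ S) :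
    IsDecomposable fun v ξ => Q (B v ξ) (B v ξ) := by
  obtain ⟨N, l', hl'⟩ := exists_eq_sum_norm_sq_of_mem hQ hB
  exact ⟨N, 0, l', fun v ξ => by simp [hl']⟩

theorem of_sesquilinear (hQ : ∀ u ∈ S, 0 ≤ Q u u) {B : T →ₗ⋆[ℂ] F →ₗ[ℂ] W}
    (hB : ∀ v ξ, B v ξ ∈ S) : IsDecomposable fun v ξ => Q (B v ξ) (B v ξ) := by
  obtain ⟨N, l, hl⟩ := exists_eq_sum_norm_sq_of_mem hQ hB
  exact ⟨N, l, 0, fun v ξ => by simp [hl]⟩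

end IsDecomposable

/-- Decomposable positivity of a curvature form `f v ξ = ⟨R(v, v̄)ξ, ξ⟩` at a point. -/
def IsDecomposablyPositive (f : T → F → ℂ) : Prop :=
  IsDecomposable f ∧ ∀ v ξ, v ≠ 0 → ξ ≠ 0 → f v ξ ≠ 0

theorem isDecomposablyPositive_of_isPosDefOn {W' : Type*} [AddCommGroup W'] [Module ℂ W']
    [FiniteDimensional ℂ W] [FiniteDimensional ℂ W'] {f : T → F → ℂ}
    {Q : W →ₗ⋆[ℂ] W →ₗ[ℂ] ℂ} {S : Submodule ℂ W} (hQ : IsPosDefOn Q S)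
    {Q' : W' →ₗ⋆[ℂ] W' →ₗ[ℂ] ℂ} {S' : Submodule ℂ W'} (hQ' : IsPosDefOn Q' S')
    {B : T →ₗ[ℂ] F →ₗ[ℂ] W} (hB : ∀ v ξ, B v ξ ∈ S)
    {B' : T →ₗ⋆[ℂ] F →ₗ[ℂ] W'} (hB' : ∀ v ξ, B' v ξ ∈ S')
    (hf : ∀ v ξ, f v ξ = Q (B v ξ) (B v ξ) + Q' (B' v ξ) (B' v ξ))
    (hne : ∀ v ξ, v ≠ 0 → ξ ≠ 0 → B v ξ ≠ 0 ∨ B' v ξ ≠ 0) : IsDecomposablyPositive f := by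
  obtain rfl : f = _ := funext₂ hf
  refine ⟨(IsDecomposable.of_bilinear (fun _ => hQ.nonneg) hB).add
    (IsDecomposable.of_sesquilinear (fun _ => hQ'.nonneg) hB'), fun v ξ hv hξ => ne_of_gt ?_⟩
  rcases hne v ξ hv hξ with h | h
  · exact add_pos_of_pos_of_nonneg (hQ _ (hB v ξ) h) (hQ'.nonneg (hB' v ξ))
  · exact add_pos_of_nonneg_of_pos (hQ.nonneg (hB v ξ)) (hQ' _ (hB' v ξ) h)

end SumsOfSquares

section CoordinateTensors

variable {ι κ F T : Type*} [AddCommGroup F] [Module ℂ F] [AddCommGroup T] [Module ℂ T]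

/-- The coordinates of `ξ ⊗ v` with respect to the bases `e` of `F` and `b` of `T`. -/
noncomputable def tensorCoord (e : Basis ι ℂ F) (b : Basis κ ℂ T) :
    T →ₗ[ℂ] F →ₗ[ℂ] (ι → κ → ℂ) :=
  LinearMap.mk₂ ℂ (fun v ξ i α => e.repr ξ i * b.repr v α)
    (fun _ _ _ => by ext; simp [mul_add]) (fun _ _ _ => by ext; simp [mul_left_comm])
    (fun _ _ _ => by ext; simp [add_mul]) (fun _ _ _ => by ext; simp [mul_assoc])

variable (e : Basis ι ℂ F) (b : Basis κ ℂ T)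

theorem tensorCoord_apply (v : T) (ξ : F) (i : ι) (α : κ) :
    tensorCoord e b v ξ i α = e.repr ξ i * b.repr v α := rfl

theorem tensorCoord_eq_zero {v : T} {ξ : F} : tensorCoord e b v ξ = 0 ↔ v = 0 ∨ ξ = 0 := by
  refine ⟨fun h => ?_, ?_⟩
  · by_contra! hne
    obtain ⟨α, hα⟩ := Finsupp.ne_iff.1 (b.repr.map_ne_zero_iff.2 hne.1)
    obtain ⟨i, hi⟩ := Finsupp.ne_iff.1 (e.repr.map_ne_zero_iff.2 hne.2)
    exact mul_ne_zero hi hα (congrFun₂ h i α)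
  · rintro (rfl | rfl) <;> simp

section LeftTensors

variable [Fintype ι]

/-- The coordinates of the tensors in `F' ⊗ T`. -/
noncomputable def leftTensors (e : Basis ι ℂ F) (κ : Type*) (F' : Submodule ℂ F) :
    Submodule ℂ (ι → κ → ℂ) :=
  ⨅ α : κ, F'.comap (e.equivFun.symm.toLinearMap ∘ₗ LinearMap.compLeft (LinearMap.proj α) ι)

theorem mem_leftTensors {F' : Submodule ℂ F} {u : ι → κ → ℂ} :
    u ∈ leftTensors e κ F' ↔ ∀ α, ∑ i, u i α • e i ∈ F' := by
  simp [leftTensors, Basis.equivFun_symm_apply]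

theorem tensorCoord_mem_leftTensors {F' : Submodule ℂ F} (v : T) {ξ : F} (hξ : ξ ∈ F') :
    tensorCoord e b v ξ ∈ leftTensors e κ F' := by
  refine (mem_leftTensors e).2 fun α => ?_
  simpa only [tensorCoord_apply, mul_comm _ (b.repr v α), mul_smul, ← Finset.smul_sum, e.sum_repr]
    using F'.smul_mem _ hξ

end LeftTensors

section RightTensors

variable [Fintype κ]

/-- The coordinates of the tensors in `F ⊗ U`. -/
noncomputable def rightTensors (ι : Type*) (b : Basis κ ℂ T) (U : Submodule ℂ T) :
    Submodule ℂ (ι → κ → ℂ) :=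
  Submodule.pi Set.univ fun _ => U.comap b.equivFun.symm.toLinearMap

theorem mem_rightTensors {U : Submodule ℂ T} {u : ι → κ → ℂ} :
    u ∈ rightTensors ι b U ↔ ∀ i, ∑ α, u i α • b α ∈ U := by
  simp [rightTensors, Basis.equivFun_symm_apply]

theorem tensorCoord_mem_rightTensors {U : Submodule ℂ T} {v : T} (hv : v ∈ U) (ξ : F) :
    tensorCoord e b v ξ ∈ rightTensors ι b U := by
  refine (mem_rightTensors b).2 fun i => ?_
  simpa only [tensorCoord_apply, mul_smul, ← Finset.smul_sum, b.sum_repr] using U.smul_mem _ hv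

/-- Complex conjugation of the coordinates in the basis `b`. -/
noncomputable def coordConj : T →ₗ⋆[ℂ] T :=
  (b.equivFun.symm.toLinearMap ∘ₛₗ (starLinearEquiv ℂ (A := κ → ℂ)).toLinearMap) ∘ₛₗ
    b.equivFun.toLinearMap

@[simp]
theorem repr_coordConj (v : T) (α : κ) : b.repr (coordConj b v) α = conj (b.repr v α) :=
  congrFun (b.equivFun.apply_symm_apply (star (b.equivFun v))) α

@[simp]
theorem coordConj_coordConj (v : T) : coordConj b (coordConj b v) = v :=
  b.ext_elem fun α => by simp

theorem coordConj_eq_zero {v : T} : coordConj b v = 0 ↔ v = 0 :=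
  ⟨fun h => by rw [← coordConj_coordConj b v, h, map_zero], fun h => by rw [h, map_zero]⟩

theorem tensorCoord_coordConj_eq_zero {v : T} {ξ : F} :
    tensorCoord e b (coordConj b v) ξ = 0 ↔ tensorCoord e b v ξ = 0 := by
  simp only [tensorCoord_eq_zero, coordConj_eq_zero]

theorem mem_rightTensors_comap_coordConj {V : Submodule ℂ T} {u : ι → κ → ℂ} :
    u ∈ rightTensors ι b (V.comap (coordConj b)) ↔ star u ∈ rightTensors ι b V := by
  classical
  have coordConj_basis (α) : coordConj b (b α) = b α := b.ext_elem fun β => by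
    simp [Finsupp.single_apply, apply_ite]
  simp [mem_rightTensors, coordConj_basis]

end RightTensors

section CoeffForm

variable [Fintype ι] [Fintype κ]

/-- The sesquilinear form `∑ c_{i j̄ α β̄} u^{iα} \overline{w^{jβ}}`, conjugate linear in its first
argument `w` and linear in its second argument `u`. -/
noncomputable def coeffForm (c : ι → ι → κ → κ → ℂ) :
    (ι → κ → ℂ) →ₗ⋆[ℂ] (ι → κ → ℂ) →ₗ[ℂ] ℂ :=
  LinearMap.mk₂'ₛₗ (starRingEnd ℂ) (RingHom.id ℂ)
    (fun w u => ∑ i, ∑ j, ∑ α, ∑ β, c i j α β * u i α * conj (w j β))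
    (fun _ _ _ => by simp [mul_add, Finset.sum_add_distrib])
    (fun _ _ _ => by simp [Finset.mul_sum, mul_left_comm])
    (fun _ _ _ => by simp [mul_add, add_mul, Finset.sum_add_distrib])
    (fun _ _ _ => by simp [Finset.mul_sum, mul_left_comm, mul_assoc])

theorem coeffForm_apply (c : ι → ι → κ → κ → ℂ) (w u : ι → κ → ℂ) :
    coeffForm c w u = ∑ i, ∑ j, ∑ α, ∑ β, c i j α β * u i α * conj (w j β) := rfl

theorem coeffForm_swap_apply (c : ι → ι → κ → κ → ℂ) (w u : ι → κ → ℂ) :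
    coeffForm (fun i j α β => c i j β α) w u =
      ∑ i, ∑ j, ∑ α, ∑ β, c i j α β * u i β * conj (w j α) :=
  Finset.sum_congr rfl fun _ _ => Finset.sum_congr rfl fun _ _ => Finset.sum_comm

theorem coeffForm_swap_tensorCoord_coordConj (c : ι → ι → κ → κ → ℂ) (v w : T) (ξ η : F) :
    coeffForm (fun i j α β => c i j β α) (tensorCoord e b (coordConj b v) η)
      (tensorCoord e b (coordConj b w) ξ) =
    coeffForm c (tensorCoord e b w η) (tensorCoord e b v ξ) := by
  rw [coeffForm_swap_apply, coeffForm_apply]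
  simp only [tensorCoord_apply, repr_coordConj, map_mul, Complex.conj_conj]
  exact Fintype.sum_congr _ _ fun i => Fintype.sum_congr _ _ fun j =>
    Fintype.sum_congr _ _ fun α => Fintype.sum_congr _ _ fun β => by ring

theorem coeffForm_swap_star_star (c : ι → ι → κ → κ → ℂ) (v : ι → κ → ℂ) :
    coeffForm (fun i j α β => c i j β α) (star v) (star v) =
      ∑ i, ∑ j, ∑ α, ∑ β, c i j α β * v j α * conj (v i β) := by
  simp [coeffForm_swap_apply, mul_right_comm]

end CoeffForm

end CoordinateTensors

section Wirtinger

variable {n : ℕ} {f g : CSpace n → ℂ} {z : CSpace n}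

theorem fderiv_conj_apply (f : CSpace n → ℂ) (z a : CSpace n) :
    fderiv ℝ (fun w => conj (f w)) z a = conj (fderiv ℝ f z a) :=
  congrArg (fun L : CSpace n →L[ℝ] ℂ => L a) Complex.conjCLE.comp_fderiv

theorem conj_wirtinger (α : Fin n) (f : CSpace n → ℂ) (z : CSpace n) :
    conj (wirtinger α f z) = wirtingerBar α (fun w => conj (f w)) z := by
  simp [wirtinger, wirtingerBar, fderiv_conj_apply, Complex.conj_ofNat]

theorem conj_wirtingerBar (β : Fin n) (f : CSpace n → ℂ) (z : CSpace n) :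
    conj (wirtingerBar β f z) = wirtinger β (fun w => conj (f w)) z := by
  simp [wirtinger, wirtingerBar, fderiv_conj_apply, sub_eq_add_neg, Complex.conj_ofNat]

theorem wirtingerBar_congr (β : Fin n) (hfg : f =ᶠ[nhds z] g) :
    wirtingerBar β f z = wirtingerBar β g z := by
  simp only [wirtingerBar, hfg.fderiv_eq]

theorem wirtingerBar_sum {ι : Type*} [Fintype ι] {f : ι → CSpace n → ℂ} (β : Fin n)
    (hf : ∀ j, DifferentiableAt ℝ (f j) z) :
    wirtingerBar β (fun w => ∑ j, f j w) z = ∑ j, wirtingerBar β (f j) z := by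
  simp only [wirtingerBar, fderiv_fun_sum fun j _ => hf j, sum_apply, Finset.mul_sum,
    Finset.sum_add_distrib, mul_add]

theorem wirtingerBar_mul (β : Fin n) (hf : DifferentiableAt ℝ f z) (hg : DifferentiableAt ℝ g z) :
    wirtingerBar β (fun w => f w * g w) z =
      f z * wirtingerBar β g z + wirtingerBar β f z * g z := by
  simp only [wirtingerBar, fderiv_fun_mul hf hg, add_apply, smul_apply, smul_eq_mul]
  ring

theorem hasFDerivAt_fderiv_apply (hf : DifferentiableAt ℝ (fderiv ℝ f) z) (a : CSpace n) :
    HasFDerivAt (fun w => fderiv ℝ f w a) ((fderiv ℝ (fderiv ℝ f) z).flip a) z :=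
  (ContinuousLinearMap.apply ℝ ℂ a).hasFDerivAt.comp z hf.hasFDerivAt

theorem hasFDerivAt_wirtinger (hf : DifferentiableAt ℝ (fderiv ℝ f) z) (α : Fin n) :
    HasFDerivAt (wirtinger α f)
      ((1 / 2 : ℂ) • ((fderiv ℝ (fderiv ℝ f) z).flip (EuclideanSpace.single α 1) -
        Complex.I • (fderiv ℝ (fderiv ℝ f) z).flip (EuclideanSpace.single α Complex.I))) z :=
  ((hasFDerivAt_fderiv_apply hf _).sub
    ((hasFDerivAt_fderiv_apply hf _).const_mul _)).const_mul _

theorem hasFDerivAt_wirtingerBar (hf : DifferentiableAt ℝ (fderiv ℝ f) z) (β : Fin n) :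
    HasFDerivAt (wirtingerBar β f)
      ((1 / 2 : ℂ) • ((fderiv ℝ (fderiv ℝ f) z).flip (EuclideanSpace.single β 1) +
        Complex.I • (fderiv ℝ (fderiv ℝ f) z).flip (EuclideanSpace.single β Complex.I))) z :=
  ((hasFDerivAt_fderiv_apply hf _).add
    ((hasFDerivAt_fderiv_apply hf _).const_mul _)).const_mul _

theorem differentiableAt_fderiv (hf : ContDiffAt ℝ 2 f z) : DifferentiableAt ℝ (fderiv ℝ f) z :=
  (hf.fderiv_right (m := 1) (by norm_num)).differentiableAt one_ne_zero

theorem wirtingerBar_wirtinger_comm (hf : ContDiffAt ℝ 2 f z) (α β : Fin n) :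
    wirtingerBar β (wirtinger α f) z = wirtinger α (wirtingerBar β f) z := by
  have hsymm : IsSymmSndFDerivAt ℝ f z := hf.isSymmSndFDerivAt (by simp)
  have hd := differentiableAt_fderiv hf
  rw [wirtingerBar, wirtinger, (hasFDerivAt_wirtinger hd α).fderiv,
    (hasFDerivAt_wirtingerBar hd β).fderiv]
  simp only [smul_apply, sub_apply, add_apply, ContinuousLinearMap.flip_apply, smul_eq_mul,
    hsymm (EuclideanSpace.single β _)]
  ring

end Wirtinger

section MatrixInverse

variable {𝕜 V m : Type*} [NontriviallyNormedField 𝕜] [NormedAddCommGroup V] [NormedSpace 𝕜 V]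
  [Fintype m] [DecidableEq m] {z : V}

section NormedCommRing

variable {A : Type*} [NormedCommRing A] [NormedAlgebra 𝕜 A] {M : V → Matrix m m A}

theorem differentiableAt_det (hM : ∀ i j, DifferentiableAt 𝕜 (fun w => M w i j) z) :
    DifferentiableAt 𝕜 (fun w => (M w).det) z := by
  simp only [Matrix.det_apply']
  fun_prop

theorem differentiableAt_adjugate_apply (hM : ∀ i j, DifferentiableAt 𝕜 (fun w => M w i j) z)
    (i j : m) : DifferentiableAt 𝕜 (fun w => (M w).adjugate i j) z := by
  simp only [Matrix.adjugate_apply]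
  refine differentiableAt_det fun k l => ?_
  rcases eq_or_ne k j with rfl | hk
  · simp
  · simpa only [Matrix.updateRow_ne hk] using hM k l

end NormedCommRing

theorem differentiableAt_matrix_inv_apply {A : Type*} [NormedField A] [NormedAlgebra 𝕜 A]
    {M : V → Matrix m m A}
    (hM : ∀ i j, DifferentiableAt 𝕜 (fun w => M w i j) z) (hdet : (M z).det ≠ 0) (i j : m) :
    DifferentiableAt 𝕜 (fun w => (M w)⁻¹ i j) z := by
  simp only [Matrix.inv_def, Matrix.smul_apply, Ring.inverse_eq_inv', smul_eq_mul]
  exact ((differentiableAt_det hM).inv hdet).mul (differentiableAt_adjugate_apply hM i j)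

end MatrixInverse

theorem frameDomain_mem_nhds (n r : ℕ) {X : Type*} [TopologicalSpace X]
    [ChartedSpace (CSpace n) X] (E : X → Type*) [∀ x, AddCommGroup (E x)]
    [∀ x, TopologicalSpace (E x)] [TopologicalSpace (TotalSpace (CSpace r) E)]
    [FiberBundle (CSpace r) E] (x : X) :
    frameDomain n r E x ∈ nhds (chartAt (CSpace n) x x) := by
  refine ((chartAt (CSpace n) x).isOpen_inter_preimage_symm
    (trivializationAt (CSpace r) E x).open_baseSet).mem_nhds ⟨mem_chart_target _ x, ?_⟩
  rw [Set.mem_preimage, (chartAt (CSpace n) x).left_inv (mem_chart_source _ x)]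
  exact FiberBundle.mem_baseSet_trivializationAt (CSpace r) E x

namespace HermitianMetric

variable {n r : ℕ} {X : Type*} [TopologicalSpace X] [ChartedSpace (CSpace n) X]
  {E : X → Type*} [∀ x, AddCommGroup (E x)] [∀ x, Module ℂ (E x)] [∀ x, TopologicalSpace (E x)]
  [TopologicalSpace (TotalSpace (CSpace r) E)] [FiberBundle (CSpace r) E]
  [VectorBundle ℂ (CSpace r) E] (h : HermitianMetric n r E)

section LocalMatrix

theorem isHermitian_localMatrix (x₀ : X) (z : CSpace n) : (h.localMatrix x₀ z).IsHermitian :=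
  Matrix.IsHermitian.ext fun _ _ => h.conj_symm _ _ _

theorem conj_localMatrix (x₀ : X) (z : CSpace n) (i k : Fin r) :
    conj (h.localMatrix x₀ z i k) = h.localMatrix x₀ z k i :=
  (h.isHermitian_localMatrix x₀ z).apply k i

theorem conj_localMatrix_inv (x₀ : X) (z : CSpace n) (i k : Fin r) :
    conj ((h.localMatrix x₀ z)⁻¹ i k) = (h.localMatrix x₀ z)⁻¹ k i :=
  (h.isHermitian_localMatrix x₀ z).inv.apply k i

theorem localMatrix_chartAt_self (x : X) (i k : Fin r) :
    h.localMatrix x (chartAt (CSpace n) x x) i k =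
      h.form x (fibreFrame E x i) (fibreFrame E x k) := by
  rw [← localHolFrame_self, ← localHolFrame_self, localMatrix, Matrix.of_apply,
    (chartAt (CSpace n) x).left_inv (mem_chart_source _ x)]

variable {x₀ : X} {z : CSpace n}

theorem posDef_localMatrix (hz : z ∈ frameDomain n r E x₀) : (h.localMatrix x₀ z).PosDef := by
  refine Matrix.PosDef.of_dotProduct_mulVec_pos (h.isHermitian_localMatrix x₀ z) fun a ha => ?_
  set y := (chartAt (CSpace n) x₀).symm z
  let b := (trivializationAt (CSpace r) E x₀).basisAt (stdBasis r) hz.2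
  have localHolFrame_eq (i) : localHolFrame E x₀ i y = b i :=
    (trivializationAt (CSpace r) E x₀).localFrame_apply_of_mem_baseSet (stdBasis r) hz.2
  let ξ := b.equivFun.symm (star a)
  have hξ : ξ ≠ 0 := b.equivFun.symm.map_ne_zero_iff.2 (star_ne_zero.2 ha)
  calc 0 < h.form y ξ ξ := h.pos y ξ hξ
    _ = ∑ i, ∑ k, star a i * (h.form y (b i) (b k) * a k) := by
      simp only [ξ, Basis.equivFun_symm_apply, map_sum, map_smul, LinearMap.map_smulₛₗ,
        LinearMap.sum_apply, LinearMap.smul_apply, smul_eq_mul, Finset.mul_sum]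
      rw [Finset.sum_comm]
      refine Fintype.sum_congr _ _ fun i => Fintype.sum_congr _ _ fun k => ?_
      simp only [Pi.star_apply, RCLike.star_def, Complex.conj_conj]
      ring
    _ = star a ⬝ᵥ h.localMatrix x₀ z *ᵥ a := by
      simp only [dotProduct, Matrix.mulVec, Finset.mul_sum, localMatrix, Matrix.of_apply,
        ← localHolFrame_eq, y]

theorem contDiffAt_localMatrix (hz : frameDomain n r E x₀ ∈ nhds z) (i k : Fin r) :
    ContDiffAt ℝ 2 (fun w => h.localMatrix x₀ w i k) z :=
  ((h.smooth x₀ i k).contDiffAt hz).of_le ENat.LEInfty.out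

theorem differentiableAt_localMatrix (hz : frameDomain n r E x₀ ∈ nhds z) (i k : Fin r) :
    DifferentiableAt ℝ (fun w => h.localMatrix x₀ w i k) z :=
  (h.contDiffAt_localMatrix hz i k).differentiableAt two_ne_zero

theorem sum_connectionForm_mul_localMatrix (hz : z ∈ frameDomain n r E x₀) (i l : Fin r)
    (α : Fin n) :
    ∑ j, h.connectionForm x₀ j i α z * h.localMatrix x₀ z j l =
      wirtinger α (fun w => h.localMatrix x₀ w i l) z := by
  have inv_mul : (h.localMatrix x₀ z)⁻¹ * h.localMatrix x₀ z = 1 :=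
    Matrix.nonsing_inv_mul _ ((Matrix.isUnit_iff_isUnit_det _).1 (h.posDef_localMatrix hz).isUnit)
  let dH : Fin r → ℂ := fun k => wirtinger α (fun w => h.localMatrix x₀ w i k) z
  calc _ = (dH ᵥ* (h.localMatrix x₀ z)⁻¹ ᵥ* h.localMatrix x₀ z) l := rfl
    _ = dH l := by rw [Matrix.vecMul_vecMul, inv_mul, Matrix.vecMul_one]

theorem differentiableAt_connectionForm (hz : frameDomain n r E x₀ ∈ nhds z) (j i : Fin r)
    (α : Fin n) : DifferentiableAt ℝ (h.connectionForm x₀ j i α) z := by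
  refine DifferentiableAt.fun_sum fun k _ => DifferentiableAt.fun_mul ?_ ?_
  · exact (hasFDerivAt_wirtinger
      (differentiableAt_fderiv (h.contDiffAt_localMatrix hz i k)) α).differentiableAt
  · exact differentiableAt_matrix_inv_apply (h.differentiableAt_localMatrix hz)
      ((Matrix.isUnit_iff_isUnit_det _).1
        (h.posDef_localMatrix (mem_of_mem_nhds hz)).isUnit).ne_zero k j

end LocalMatrix

section Curvature

theorem chernCurvature_tangentFrame (x : X) (α β : Fin n) :
    h.chernCurvature x (tangentFrame x α) (tangentFrame x β) =
      Matrix.toLin (fibreFrame E x) (fibreFrame E x) (h.curvatureMatrix x α β) := by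
  simp [chernCurvature, Finsupp.single_apply, Finset.sum_ite_eq]

theorem curvatureCoeff_eq_sum (x : X) (i l : Fin r) (α β : Fin n) :
    h.curvatureCoeff x i l α β = ∑ j, h.curvatureMatrix x α β j i *
      h.localMatrix x (chartAt (CSpace n) x x) j l := by
  simp [curvatureCoeff, chernCurvature_tangentFrame, Matrix.toLin_self, localMatrix_chartAt_self]

theorem curvatureCoeff_eq (x : X) (i l : Fin r) (α β : Fin n) :
    h.curvatureCoeff x i l α β =
      ∑ j, h.connectionForm x j i α (chartAt (CSpace n) x x) *
          wirtingerBar β (fun w => h.localMatrix x w j l) (chartAt (CSpace n) x x) -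
        wirtingerBar β (wirtinger α fun w => h.localMatrix x w i l) (chartAt (CSpace n) x x) := by
  set z := chartAt (CSpace n) x x
  have hD : frameDomain n r E x ∈ nhds z := frameDomain_mem_nhds n r E x
  have connection_mul_metric :
      (fun w => ∑ j, h.connectionForm x j i α w * h.localMatrix x w j l) =ᶠ[nhds z]
        wirtinger α fun w => h.localMatrix x w i l := by
    filter_upwards [hD] with w hw using h.sum_connectionForm_mul_localMatrix hw i l α
  have hθ (j) := h.differentiableAt_connectionForm hD j i α
  have hH (j) := h.differentiableAt_localMatrix hD j l
  rw [curvatureCoeff_eq_sum, ← wirtingerBar_congr β connection_mul_metric,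
    wirtingerBar_sum β fun j => (hθ j).fun_mul (hH j)]
  simp only [wirtingerBar_mul β (hθ _) (hH _), Finset.sum_add_distrib, curvatureMatrix,
    Matrix.of_apply, neg_mul, Finset.sum_neg_distrib]
  ring

theorem conj_curvatureCoeff (x : X) (i l : Fin r) (α β : Fin n) :
    conj (h.curvatureCoeff x i l α β) = h.curvatureCoeff x l i β α := by
  have second_order : conj (wirtingerBar β (wirtinger α fun w => h.localMatrix x w i l)
        (chartAt (CSpace n) x x)) =
      wirtingerBar α (wirtinger β fun w => h.localMatrix x w l i) (chartAt (CSpace n) x x) := by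
    rw [conj_wirtingerBar, wirtingerBar_wirtinger_comm
      (h.contDiffAt_localMatrix (frameDomain_mem_nhds n r E x) l i)]
    simp only [conj_wirtinger, conj_localMatrix]
  rw [curvatureCoeff_eq, curvatureCoeff_eq, map_sub, second_order]
  congr 1
  simp only [connectionForm, Finset.sum_mul, map_sum, map_mul, conj_wirtinger, conj_wirtingerBar,
    conj_localMatrix, conj_localMatrix_inv]
  rw [Finset.sum_comm]
  exact Fintype.sum_congr _ _ fun j => Fintype.sum_congr _ _ fun k => by ring

theorem nakanoForm_eq_coeffForm (x : X) (u w : Fin r → Fin n → ℂ) :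
    h.nakanoForm x u w = coeffForm (h.curvatureCoeff x) w u := rfl

theorem conj_nakanoForm (x : X) (u w : Fin r → Fin n → ℂ) :
    conj (h.nakanoForm x u w) = h.nakanoForm x w u := by
  simp only [nakanoForm, map_sum, map_mul, conj_curvatureCoeff, Complex.conj_conj]
  rw [Finset.sum_comm]
  refine Fintype.sum_congr _ _ fun i => Fintype.sum_congr _ _ fun j => ?_
  rw [Finset.sum_comm]
  exact Fintype.sum_congr _ _ fun α => Fintype.sum_congr _ _ fun β => by ring

variable (E) in
/-- The coordinates of the tensor `ξ ⊗ v ∈ E_x ⊗ T¹'⁰ₓX` in the frames `(e_i)` and `(∂_α)`. -/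
noncomputable abbrev frameCoord (x : X) :
    TangentSpace 𝓘(ℂ, CSpace n) x →ₗ[ℂ] E x →ₗ[ℂ] (Fin r → Fin n → ℂ) :=
  tensorCoord (fibreFrame E x) (tangentFrame x)

theorem form_chernCurvature (x : X) (v w : TangentSpace 𝓘(ℂ, CSpace n) x) (ξ η : E x) :
    h.form x (h.chernCurvature x v w ξ) η =
      h.nakanoForm x (frameCoord E x v ξ) (frameCoord E x w η) := by
  have chernCurvature_eq_sum : h.chernCurvature x v w =
      ∑ α, ∑ β, ((tangentFrame x).repr v α * conj ((tangentFrame x).repr w β)) •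
        h.chernCurvature x (tangentFrame x α) (tangentFrame x β) := by
    simp only [chernCurvature_tangentFrame]
    rfl
  conv_lhs => rw [chernCurvature_eq_sum, ← (fibreFrame (r := r) E x).sum_repr ξ,
    ← (fibreFrame (r := r) E x).sum_repr η]
  simp only [LinearMap.sum_apply, LinearMap.smul_apply, map_sum, map_smul, LinearMap.map_smulₛₗ,
    smul_eq_mul, nakanoForm, curvatureCoeff, tensorCoord_apply, map_mul, Finset.mul_sum]
  rw [Finset.sum_comm]
  exact Fintype.sum_congr _ _ fun i => Fintype.sum_congr _ _ fun j =>
    Fintype.sum_congr _ _ fun α => Fintype.sum_congr _ _ fun β => by ring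

theorem coeffForm_swap_frameCoord_coordConj (x : X) (v : TangentSpace 𝓘(ℂ, CSpace n) x) (ξ : E x) :
    coeffForm (fun i j α β => h.curvatureCoeff x i j β α)
        (frameCoord E x (coordConj (tangentFrame x) v) ξ)
        (frameCoord E x (coordConj (tangentFrame x) v) ξ) =
      h.nakanoForm x (frameCoord E x v ξ) (frameCoord E x v ξ) :=
  coeffForm_swap_tensorCoord_coordConj (fibreFrame E x) (tangentFrame x) _ v v ξ ξ

end Curvature

theorem decomposablyPositive_of_forall (hf : ∀ x, IsDecomposablyPositive
      fun (v : TangentSpace 𝓘(ℂ, CSpace n) x) ξ => h.form x (h.chernCurvature x v v ξ) ξ) :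
    h.DecomposablyPositive := by
  refine ⟨fun x => ?_, fun x => (hf x).2⟩
  have scaled := (hf x).1.const_mul (c := 1 / (2 * Real.pi)) (by positivity)
  simpa [IsDecomposable] using scaled

variable {h}

theorem nakanoForm_add_self {x : X} {u w : Fin r → Fin n → ℂ} (huw : h.nakanoForm x u w = 0) :
    h.nakanoForm x (u + w) (u + w) = h.nakanoForm x u u + h.nakanoForm x w w := by
  have hwu : h.nakanoForm x w u = 0 := by rw [← conj_nakanoForm, huw, map_zero]
  rw [nakanoForm_eq_coeffForm] at huw hwu
  simp only [nakanoForm_eq_coeffForm, map_add, LinearMap.add_apply, huw, hwu, add_zero, zero_add]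

variable {x : X}

theorem isDecomposablyPositive_of_split {S S' : Submodule ℂ (Fin r → Fin n → ℂ)}
    (hS : IsPosDefOn (coeffForm (h.curvatureCoeff x)) S)
    (hS' : IsPosDefOn (coeffForm fun i j α β => h.curvatureCoeff x i j β α) S')
    {p p' : TangentSpace 𝓘(ℂ, CSpace n) x →ₗ[ℂ] TangentSpace 𝓘(ℂ, CSpace n) x}
    {q q' : E x →ₗ[ℂ] E x}
    (mem_S : ∀ v ξ, frameCoord E x (p v) (q ξ) ∈ S)
    (mem_S' : ∀ v ξ, frameCoord E x (coordConj (tangentFrame x) (p' v)) (q' ξ) ∈ S')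
    (split : ∀ v ξ, (frameCoord E x v ξ : Fin r → Fin n → ℂ) =
      frameCoord E x (p v) (q ξ) + frameCoord E x (p' v) (q' ξ))
    (cross : ∀ v ξ,
      h.nakanoForm x (frameCoord E x (p v) (q ξ)) (frameCoord E x (p' v) (q' ξ)) = 0) :
    IsDecomposablyPositive fun (v : TangentSpace 𝓘(ℂ, CSpace n) x) ξ =>
      h.form x (h.chernCurvature x v v ξ) ξ := by
  let B : TangentSpace 𝓘(ℂ, CSpace n) x →ₗ[ℂ] E x →ₗ[ℂ] (Fin r → Fin n → ℂ) :=
    (frameCoord E x).compl₁₂ p q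
  let B' : TangentSpace 𝓘(ℂ, CSpace n) x →ₗ⋆[ℂ] E x →ₗ[ℂ] (Fin r → Fin n → ℂ) :=
    (frameCoord E x).compl₂ q' ∘ₛₗ coordConj (tangentFrame x) ∘ₛₗ p'
  have hB (v ξ) : B v ξ = frameCoord E x (p v) (q ξ) := rfl
  have hB' (v ξ) : B' v ξ = frameCoord E x (coordConj (tangentFrame x) (p' v)) (q' ξ) := rfl
  refine isDecomposablyPositive_of_isPosDefOn hS hS' (B := B) (B' := B') mem_S mem_S'
    (fun v ξ => ?_) (fun v ξ hv hξ => ?_)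
  · rw [form_chernCurvature, split, nakanoForm_add_self (cross v ξ),
      nakanoForm_eq_coeffForm, hB, hB', coeffForm_swap_frameCoord_coordConj]
  · by_contra! hzero
    rw [hB, hB', tensorCoord_coordConj_eq_zero] at hzero
    have frameCoord_eq_zero : (frameCoord E x v ξ : Fin r → Fin n → ℂ) = 0 := by
      rw [split, hzero.1, hzero.2, add_zero]
    exact ((tensorCoord_eq_zero _ _).1 frameCoord_eq_zero).elim hv hξ

theorem StronglyDecomposablyPositiveI.decomposablyPositive
    (hI : h.StronglyDecomposablyPositiveI) : h.DecomposablyPositive := by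
  refine h.decomposablyPositive_of_forall fun x => ?_
  obtain ⟨U, V, hUV, hU, hcross, hV⟩ := hI x
  let e : Basis (Fin r) ℂ (E x) := fibreFrame E x
  let b : Basis (Fin n) ℂ (TangentSpace 𝓘(ℂ, CSpace n) x) := tangentFrame x
  let p := U.projection V hUV
  let p' := V.projection U hUV.symm
  have hp (v) : p v ∈ U := Submodule.projection_apply_mem hUV v
  have hp' (v) : p' v ∈ V := Submodule.projection_apply_mem hUV.symm v
  have hp'_conj (v) : coordConj b (p' v) ∈ V.comap (coordConj b) := by
    simpa only [Submodule.mem_comap, coordConj_coordConj] using hp' v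
  have p_add_p' (v) : p v + p' v = v := Submodule.projection_add_projection_eq_self hUV v
  have hS : IsPosDefOn (coeffForm (h.curvatureCoeff x)) (rightTensors (Fin r) b U) :=
    fun u hu => hU u ((mem_rightTensors b).1 hu)
  have hS' : IsPosDefOn (coeffForm fun i j α β => h.curvatureCoeff x i j β α)
      (rightTensors (Fin r) b (V.comap (coordConj b))) := by
    intro u hu hu0
    rw [mem_rightTensors_comap_coordConj, mem_rightTensors] at hu
    simpa only [dualNakanoForm, ← coeffForm_swap_star_star, star_star] using
      hV (star u) hu (star_ne_zero.2 hu0)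
  refine isDecomposablyPositive_of_split hS hS' (p := p) (p' := p') (q := .id) (q' := .id)
    (fun v ξ => tensorCoord_mem_rightTensors e b (hp v) ξ)
    (fun v ξ => tensorCoord_mem_rightTensors e b (hp'_conj v) ξ)
    (fun v ξ => ?_) (fun v ξ => ?_)
  · simp only [LinearMap.id_apply, ← LinearMap.add_apply, ← map_add, p_add_p']
  · exact hcross _ _ ((mem_rightTensors b).1 (tensorCoord_mem_rightTensors e b (hp v) ξ))
      ((mem_rightTensors b).1 (tensorCoord_mem_rightTensors e b (hp' v) ξ))

theorem StronglyDecomposablyPositiveII.decomposablyPositive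
    (hII : h.StronglyDecomposablyPositiveII) : h.DecomposablyPositive := by
  refine h.decomposablyPositive_of_forall fun x => ?_
  obtain ⟨E₁, E₂, hE, horth, hblock, hE₁, hE₂⟩ := hII x
  let e : Basis (Fin r) ℂ (E x) := fibreFrame E x
  let b : Basis (Fin n) ℂ (TangentSpace 𝓘(ℂ, CSpace n) x) := tangentFrame x
  let q := E₁.projection E₂ hE
  let q' := E₂.projection E₁ hE.symm
  have hq (ξ) : q ξ ∈ E₁ := Submodule.projection_apply_mem hE ξ
  have hq' (ξ) : q' ξ ∈ E₂ := Submodule.projection_apply_mem hE.symm ξ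
  have q_add_q' (ξ) : q ξ + q' ξ = ξ := Submodule.projection_add_projection_eq_self hE ξ
  have hS : IsPosDefOn (coeffForm (h.curvatureCoeff x)) (leftTensors e (Fin n) E₁) :=
    fun u hu => hE₁ u ((mem_leftTensors e).1 hu)
  have hS' : IsPosDefOn (coeffForm fun i j α β => h.curvatureCoeff x i j β α)
      (leftTensors e (Fin n) E₂) := by
    intro u hu hu0
    rw [coeffForm_swap_apply]
    exact hE₂ u ((mem_leftTensors e).1 hu) hu0
  refine isDecomposablyPositive_of_split hS hS' (p := .id) (p' := .id) (q := q) (q' := q')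
    (fun v ξ => tensorCoord_mem_leftTensors e b v (hq ξ))
    (fun v ξ => tensorCoord_mem_leftTensors e b (coordConj b v) (hq' ξ))
    (fun v ξ => ?_) (fun v ξ => ?_)
  · simp only [LinearMap.id_apply, ← map_add, q_add_q']
  · simpa only [form_chernCurvature, LinearMap.id_apply] using
      horth _ ((hblock v v).1 _ (hq ξ)) _ (hq' ξ)

end HermitianMetric

theorem corollary2p6 {n r : ℕ}
    {X : Type*} [TopologicalSpace X] [ChartedSpace (CSpace n) X]
    [IsManifold 𝓘(ℂ, CSpace n) ω X]
    (E : X → Type*) [∀ x, AddCommGroup (E x)] [∀ x, Module ℂ (E x)]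
    [∀ x, TopologicalSpace (E x)] [TopologicalSpace (TotalSpace (CSpace r) E)]
    [FiberBundle (CSpace r) E] [VectorBundle ℂ (CSpace r) E]
    [ContMDiffVectorBundle ω (CSpace r) E 𝓘(ℂ, CSpace n)]
    (h : HermitianMetric n r E)
    (hpos : h.StronglyDecomposablyPositiveI ∨ h.StronglyDecomposablyPositiveII) :
    h.DecomposablyPositive :=
  hpos.elim (·.decomposablyPositive) (·.decomposablyPositive)
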